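/- Let $X \subset \mathbb{R}^d$ be a finite set of unit vectors and let $\mu$ be a probability distribution on $X$. For an invertible linear map $T:\mathbb{R}^d\to\mathbb{R}^d$, let $(X_T,\mu_T)$ denote the transformed pair \[ X_T=\left\{x_T=\frac{T(x)}{\|T(x)\|} : x\in X\right\},\qquad \mu_T(x_T)=\mu(x). \] For $\varepsilon>0$, a pair $(Y,\nu)$ consisting of a finite set $Y\subset\mathbb{R}^d$ of unit vectors and a probability distribution $\nu$ on $Y$ is said to be in $\varepsilon$-isotropic position if for every nonzero $v\in\mathbb{R}^d$ \[ (1-\varepsilon)\frac1d \;\le\; \sum_{y\in Y}\nu(y)\frac{\langle y,v\rangle^2}{\|v\|^2} \;\le\; (1+\varepsilon)\frac1d . \] Then the following conditions are equivalent: (a) for every $\varepsilon>0$ there exists an invertible linear map $T:\mathbb{R}^d\to\mathbb{R}^d$ such that $(X_T,\mu_T)$ is in $\varepsilon$-isotropic position; (b) for every $1\le k\le d$, every $k$-dimensional linear subspace $V\subseteq\mathbb{R}^d$ satisfies $\mu(V\cap X)\le \frac{k}{d}$. -/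

import Mathlib

noncomputable section

/-- The normalized image `x_T = T x / ‖T x‖` of a point `x` of `ℝ^d`. -/
def transformPoint {d : ℕ} (T : EuclideanSpace ℝ (Fin d) ≃ₗ[ℝ] EuclideanSpace ℝ (Fin d))
    (x : EuclideanSpace ℝ (Fin d)) : EuclideanSpace ℝ (Fin d) :=
  ‖T x‖⁻¹ • T x

open Classical in
/-- The transformed set `X_T = {x_T : x ∈ X}`. -/
def transformSet {d : ℕ} (T : EuclideanSpace ℝ (Fin d) ≃ₗ[ℝ] EuclideanSpace ℝ (Fin d))
    (X : Finset (EuclideanSpace ℝ (Fin d))) : Finset (EuclideanSpace ℝ (Fin d)) :=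
  X.image (transformPoint T)

open Classical in
/-- The transformed distribution `μ_T`, i.e. the image of `μ` under `x ↦ x_T`. For a set `X` of
unit vectors it is given by `μ_T (x_T) = μ x`, see `transformWeight_transformPoint`. -/
def transformWeight {d : ℕ} (T : EuclideanSpace ℝ (Fin d) ≃ₗ[ℝ] EuclideanSpace ℝ (Fin d))
    (X : Finset (EuclideanSpace ℝ (Fin d))) (μ : EuclideanSpace ℝ (Fin d) → ℝ)
    (y : EuclideanSpace ℝ (Fin d)) : ℝ :=
  ∑ x ∈ X with transformPoint T x = y, μ x

/-- The weighted point set `(X, μ)` lies in `ε`-isotropic position. (The quotient is meaningful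
for nonzero directions `v` only.) -/
def IsIsotropicPosition {d : ℕ} (ε : ℝ) (X : Finset (EuclideanSpace ℝ (Fin d)))
    (μ : EuclideanSpace ℝ (Fin d) → ℝ) : Prop :=
  ∀ v : EuclideanSpace ℝ (Fin d), v ≠ 0 →
    (1 - ε) * (1 / (d : ℝ)) ≤ ∑ x ∈ X, μ x * (inner ℝ x v ^ 2 / ‖v‖ ^ 2) ∧
    ∑ x ∈ X, μ x * (inner ℝ x v ^ 2 / ‖v‖ ^ 2) ≤ (1 + ε) * (1 / (d : ℝ))

open Classical in
/-- The mass `μ(V ∩ X)` that `(X, μ)` gives to a linear subspace `V`. -/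
def subspaceMass {d : ℕ} (X : Finset (EuclideanSpace ℝ (Fin d)))
    (μ : EuclideanSpace ℝ (Fin d) → ℝ) (V : Submodule ℝ (EuclideanSpace ℝ (Fin d))) : ℝ :=
  ∑ x ∈ X with x ∈ V, μ x

/-- `x ↦ x_T` is injective on unit vectors. -/
theorem transformPoint_inj {d : ℕ}
    (T : EuclideanSpace ℝ (Fin d) ≃ₗ[ℝ] EuclideanSpace ℝ (Fin d))
    {x y : EuclideanSpace ℝ (Fin d)} (hx : ‖x‖ = 1) (hy : ‖y‖ = 1)
    (h : transformPoint T x = transformPoint T y) : x = y := by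
  have hx0 : x ≠ 0 := by rintro rfl; simp at hx
  have hy0 : y ≠ 0 := by rintro rfl; simp at hy
  have hTx : 0 < ‖T x‖ := norm_pos_iff.2 (by simpa using hx0)
  have hTy : 0 < ‖T y‖ := norm_pos_iff.2 (by simpa using hy0)
  have h1 : ‖T x‖⁻¹ • x = ‖T y‖⁻¹ • y := T.injective (by simpa [transformPoint] using h)
  have h2 : ‖T x‖⁻¹ = ‖T y‖⁻¹ := by
    have := congrArg norm h1
    simpa [norm_smul, hx, hy] using this
  rw [h2] at h1
  exact smul_right_injective _ (inv_pos.2 hTy).ne' h1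

/-- `μ_T (x_T) = μ x` for a point `x` of a finite set `X` of unit vectors. -/
theorem transformWeight_transformPoint {d : ℕ}
    (T : EuclideanSpace ℝ (Fin d) ≃ₗ[ℝ] EuclideanSpace ℝ (Fin d))
    (X : Finset (EuclideanSpace ℝ (Fin d))) (hX : ∀ x ∈ X, ‖x‖ = 1)
    (μ : EuclideanSpace ℝ (Fin d) → ℝ) {x : EuclideanSpace ℝ (Fin d)} (hx : x ∈ X) :
    transformWeight T X μ (transformPoint T x) = μ x := by
  classical
  have : ({z ∈ X | transformPoint T z = transformPoint T x} : Finset _) = {x} := by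
    ext z
    simp only [Finset.mem_filter, Finset.mem_singleton]
    constructor
    · rintro ⟨hz, h⟩
      exact transformPoint_inj T (hX z hz) (hX x hx) h
    · rintro rfl
      exact ⟨hx, rfl⟩
  unfold transformWeight
  rw [Finset.sum_congr (s₂ := {x}) (by convert this) (fun _ _ => rfl), Finset.sum_singleton]

end

/-! (a) ⇒ (b): sum the upper isotropy bound over an orthonormal basis of the image of `V` under `T`.
Each point of `V` contributes its full mass, and ε tends to 0. (b) ⇒ (a): consider F(T) = ∑ μ(x) log
‖T x‖ - log |det T| / d. If m(u) = ∑ μ(x) ⟨x_T, u⟩², the derivative of F under a stretch along a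
unit vector u is (m(u) - 1/d) / 2, so critical points are isotropic positions. Condition (b) bounds
F below: a basis picked greedily from `X` by the cost log ‖T x‖ has average cost at most the
μ-average (`exists_linearIndependent_greedy`), and Hadamard's inequality compares its total cost
with log |det T|. The infimum need not be attained, but a near-minimizer suffices, by the
second-order estimate `exists_logEnergy_le`. -/

open Module

/-! ### Transformed sums and necessity of the mass bounds -/

/-- Sums over the transformed pair `(X_T, μ_T)` are sums over `(X, μ)`. -/
theorem sum_transformSet {d : ℕ} (T : EuclideanSpace ℝ (Fin d) ≃ₗ[ℝ] EuclideanSpace ℝ (Fin d))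
    (X : Finset (EuclideanSpace ℝ (Fin d))) (hX : ∀ x ∈ X, ‖x‖ = 1)
    (μ g : EuclideanSpace ℝ (Fin d) → ℝ) :
    ∑ y ∈ transformSet T X, transformWeight T X μ y * g y =
      ∑ x ∈ X, μ x * g (transformPoint T x) := by
  classical
  unfold transformSet
  rw [Finset.sum_image fun x hx y hy h => transformPoint_inj T (hX x hx) (hX y hy) h]
  exact Finset.sum_congr rfl fun x hx => by rw [transformWeight_transformPoint T X hX μ hx]

theorem apply_ne_zero_of_norm_eq_one {E : Type*} [NormedAddCommGroup E] [NormedSpace ℝ E]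
    (T : E ≃ₗ[ℝ] E) {x : E} (hx : ‖x‖ = 1) : T x ≠ 0 := by
  rw [Ne, T.map_eq_zero_iff]
  rintro rfl
  simp at hx

theorem norm_transformPoint {d : ℕ}
    (T : EuclideanSpace ℝ (Fin d) ≃ₗ[ℝ] EuclideanSpace ℝ (Fin d))
    {x : EuclideanSpace ℝ (Fin d)} (hx : ‖x‖ = 1) : ‖transformPoint T x‖ = 1 :=
  norm_smul_inv_norm (𝕜 := ℝ) (apply_ne_zero_of_norm_eq_one T hx)

/-- If `(X_T, μ_T)` is in `ε`-isotropic position then every subspace `V` has mass at most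
`(1 + ε) dim V / d`. -/
theorem subspaceMass_le_of_isIsotropicPosition {d : ℕ} {X : Finset (EuclideanSpace ℝ (Fin d))}
    (hX : ∀ x ∈ X, ‖x‖ = 1) {μ : EuclideanSpace ℝ (Fin d) → ℝ} (hμ : ∀ x ∈ X, 0 ≤ μ x) {ε : ℝ}
    (T : EuclideanSpace ℝ (Fin d) ≃ₗ[ℝ] EuclideanSpace ℝ (Fin d))
    (h : IsIsotropicPosition ε (transformSet T X) (transformWeight T X μ))
    (V : Submodule ℝ (EuclideanSpace ℝ (Fin d))) :
    subspaceMass X μ V ≤ (1 + ε) * (finrank ℝ V / d) := by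
  classical
  let W := V.map (T : EuclideanSpace ℝ (Fin d) →ₗ[ℝ] EuclideanSpace ℝ (Fin d))
  let b := stdOrthonormalBasis ℝ W
  have hW : finrank ℝ W = finrank ℝ V := T.finrank_map_eq V
  have hnorm (i) : ‖(b i : EuclideanSpace ℝ (Fin d))‖ = 1 := b.orthonormal.1 i
  have hb (i) : ∑ x ∈ X, μ x * inner ℝ (transformPoint T x) (b i : EuclideanSpace ℝ (Fin d)) ^ 2 ≤
      (1 + ε) * (1 / d) := by
    have h0 : (b i : EuclideanSpace ℝ (Fin d)) ≠ 0 := by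
      rw [← norm_pos_iff, hnorm]; exact one_pos
    have := (h _ h0).2
    rw [sum_transformSet T X hX μ fun y => inner ℝ y (b i : EuclideanSpace ℝ (Fin d)) ^ 2 /
      ‖(b i : EuclideanSpace ℝ (Fin d))‖ ^ 2] at this
    simpa [hnorm] using this
  calc subspaceMass X μ V
      = ∑ x ∈ X with x ∈ V, μ x := by unfold subspaceMass; congr
    _ ≤ ∑ x ∈ X with x ∈ V,
          μ x * ∑ i, inner ℝ (transformPoint T x) (b i : EuclideanSpace ℝ (Fin d)) ^ 2 := by
        refine Finset.sum_le_sum fun x hx => ?_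
        obtain ⟨hxX, hxV⟩ := Finset.mem_filter.1 hx
        have hmem : transformPoint T x ∈ W :=
          W.smul_mem _ (Submodule.mem_map_of_mem hxV)
        -- Parseval in `W`: the squared coordinates of the unit vector x_T sum to 1.
        have := b.sum_sq_inner_left ⟨_, hmem⟩
        simp only [Submodule.coe_inner, Submodule.coe_norm, norm_transformPoint T (hX x hxX)] at this
        rw [this]
        simp
    _ ≤ ∑ x ∈ X, μ x * ∑ i, inner ℝ (transformPoint T x) (b i : EuclideanSpace ℝ (Fin d)) ^ 2 :=
        Finset.sum_le_sum_of_subset_of_nonneg (Finset.filter_subset _ _) fun x hx _ =>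
          mul_nonneg (hμ x hx) (Finset.sum_nonneg fun i _ => sq_nonneg _)
    _ = ∑ i, ∑ x ∈ X, μ x * inner ℝ (transformPoint T x) (b i : EuclideanSpace ℝ (Fin d)) ^ 2 := by
        simp_rw [Finset.mul_sum]
        exact Finset.sum_comm
    _ ≤ ∑ _i : Fin (finrank ℝ W), (1 + ε) * (1 / (d : ℝ)) := Finset.sum_le_sum fun i _ => hb i
    _ = (1 + ε) * (finrank ℝ V / d) := by
        simp [hW]; ring

/-! ### Greedy independent families -/

theorem subspaceMass_bot {d : ℕ} {X : Finset (EuclideanSpace ℝ (Fin d))}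
    (hX : ∀ x ∈ X, ‖x‖ = 1) (μ : EuclideanSpace ℝ (Fin d) → ℝ) : subspaceMass X μ ⊥ = 0 := by
  classical
  unfold subspaceMass
  refine Finset.sum_eq_zero fun x hx => ?_
  obtain ⟨hxX, hx0⟩ := Finset.mem_filter.1 hx
  have := hX x hxX
  simp [(Submodule.mem_bot ℝ).1 hx0] at this

/-- The mass of a larger subspace, when `f ≥ c` on the new points. -/
theorem subspaceMass_add_le {d : ℕ} {X : Finset (EuclideanSpace ℝ (Fin d))}
    {μ : EuclideanSpace ℝ (Fin d) → ℝ} (hμ : ∀ x ∈ X, 0 ≤ μ x)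
    {f : EuclideanSpace ℝ (Fin d) → ℝ} {V W : Submodule ℝ (EuclideanSpace ℝ (Fin d))}
    (hVW : V ≤ W) {c : ℝ} (hc : ∀ x ∈ X, x ∉ V → c ≤ f x) :
    subspaceMass X (fun x => μ x * f x) V + (subspaceMass X μ W - subspaceMass X μ V) * c ≤
      subspaceMass X (fun x => μ x * f x) W := by
  classical
  unfold subspaceMass
  simp only [Finset.sum_filter, ← Finset.sum_sub_distrib, Finset.sum_mul, ← Finset.sum_add_distrib]
  refine Finset.sum_le_sum fun x hx => ?_
  by_cases hV : x ∈ V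
  · simp [hV, hVW hV]
  · by_cases hW : x ∈ W
    · simpa [hV, hW] using mul_le_mul_of_nonneg_left (hc x hx hV) (hμ x hx)
    · simp [hV, hW]

/-- A greedily chosen linearly independent family in `X` for a cost function `f`: its average
cost is controlled by the `μ`-average of `f` on its span. -/
theorem exists_linearIndependent_greedy {d : ℕ} (hd : 0 < d)
    {X : Finset (EuclideanSpace ℝ (Fin d))} (hX : ∀ x ∈ X, ‖x‖ = 1)
    {μ : EuclideanSpace ℝ (Fin d) → ℝ} (hμ0 : ∀ x ∈ X, 0 ≤ μ x) (hμ : ∑ x ∈ X, μ x = 1)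
    (hV : ∀ V : Submodule ℝ (EuclideanSpace ℝ (Fin d)),
      subspaceMass X μ V ≤ (finrank ℝ V : ℝ) / d)
    (f : EuclideanSpace ℝ (Fin d) → ℝ) {k : ℕ} (hk : k ≤ d) :
    ∃ b : Fin k → X, LinearIndependent ℝ (fun i => (b i : EuclideanSpace ℝ (Fin d))) ∧
      (∀ x ∈ X, x ∉ Submodule.span ℝ (Set.range fun i => (b i : EuclideanSpace ℝ (Fin d))) →
        ∀ i, f (b i) ≤ f x) ∧
      ∀ c, (∀ i, f (b i) ≤ c) →
        (∑ i, f (b i)) / d ≤ subspaceMass X (fun x => μ x * f x)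
          (Submodule.span ℝ (Set.range fun i => (b i : EuclideanSpace ℝ (Fin d)))) +
        (k / d - subspaceMass X μ
          (Submodule.span ℝ (Set.range fun i => (b i : EuclideanSpace ℝ (Fin d))))) * c := by
  classical
  have hd' : (0 : ℝ) < d := Nat.cast_pos.2 hd
  -- Invariant: each chosen vector is budgeted mass 1/d, and the mass k/d - μ(span) not yet found in
  -- the span is charged at a price c above all chosen costs.
  induction k with
  | zero =>
    refine ⟨Fin.elim0, linearIndependent_empty_type, fun _ _ _ i => i.elim0, fun c _ => ?_⟩
    rw [Set.range_eq_empty, Submodule.span_empty, subspaceMass_bot hX, subspaceMass_bot hX]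
    simp
  | succ k ih =>
    obtain ⟨b, hb, hmin, hle⟩ := ih (Nat.le_of_succ_le hk)
    set V := Submodule.span ℝ (Set.range fun i => (b i : EuclideanSpace ℝ (Fin d)))
    -- Otherwise `V` has mass 1 but dimension k < d.
    have hne : (X.filter fun x => x ∉ V).Nonempty := by
      by_contra hempty
      rw [Finset.not_nonempty_iff_eq_empty, Finset.filter_eq_empty_iff] at hempty
      have hone : subspaceMass X μ V = 1 := by
        rw [← hμ, subspaceMass, Finset.filter_true_of_mem fun x hx => not_not.1 (hempty hx)]
      have hrank : finrank ℝ V = k := by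
        simpa using finrank_span_eq_card hb
      have hVk := hV V
      rw [hone, hrank, le_div_iff₀ hd', one_mul] at hVk
      have : d ≤ k := by exact_mod_cast hVk
      omega
    obtain ⟨y, hy, hymin⟩ := Finset.exists_min_image _ f hne
    obtain ⟨hyX, hyV⟩ := Finset.mem_filter.1 hy
    have hsnoc : (fun i => ((Fin.snoc b ⟨y, hyX⟩ : Fin (k + 1) → X) i : EuclideanSpace ℝ (Fin d))) =
        Fin.snoc (fun i => (b i : EuclideanSpace ℝ (Fin d))) y := by
      funext i
      refine Fin.lastCases ?_ (fun i => ?_) i <;> simp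
    have hli := hb.finSnoc hyV
    have hVW : V ≤ Submodule.span ℝ (Set.range (Fin.snoc
        (fun i => (b i : EuclideanSpace ℝ (Fin d))) y : Fin (k + 1) → EuclideanSpace ℝ (Fin d))) := by
      refine Submodule.span_mono ?_
      rintro _ ⟨i, rfl⟩
      exact ⟨i.castSucc, by simp⟩
    refine ⟨Fin.snoc b ⟨y, hyX⟩, ?_⟩
    rw [hsnoc]
    have hrank : finrank ℝ (Submodule.span ℝ (Set.range (Fin.snoc
        (fun i => (b i : EuclideanSpace ℝ (Fin d))) y :
          Fin (k + 1) → EuclideanSpace ℝ (Fin d)))) = k + 1 := by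
      simpa using finrank_span_eq_card hli
    generalize Submodule.span ℝ (Set.range (Fin.snoc (fun i => (b i : EuclideanSpace ℝ (Fin d))) y :
      Fin (k + 1) → EuclideanSpace ℝ (Fin d))) = W at hVW hrank ⊢
    have hyle (x) (hx : x ∈ X) (hxV : x ∉ V) : f y ≤ f x :=
      hymin x (Finset.mem_filter.2 ⟨hx, hxV⟩)
    refine ⟨hli, fun x hx hxW => ?_, fun c hc => ?_⟩
    · have hxV : x ∉ V := fun h => hxW (hVW h)
      refine Fin.lastCases ?_ (fun i => ?_)
      · simpa using hyle x hx hxV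
      · simpa using hmin x hx hxV i
    · have hyc : f y ≤ c := by simpa using hc (Fin.last k)
      -- Charge the old deficit at price `f y`: the mass gained in `W` costs at least that much, and
      -- the new deficit is nonnegative by `hV`, so its price may rise to `c`.
      have h1 := hle (f y) (hmin y hyX hyV)
      have h2 := subspaceMass_add_le hμ0 hVW hyle
      have h3 := hV W
      rw [hrank] at h3
      have h4 := mul_le_mul_of_nonneg_left hyc (sub_nonneg.2 h3)
      rw [Fin.sum_univ_castSucc]
      simp only [Fin.snoc_castSucc, Fin.snoc_last]
      push_cast at h4 ⊢
      simp only [add_div] at h4 ⊢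
      have h5 : (1 : ℝ) / d * f y = f y / d := by ring
      linarith

/-! ### Lower bound for the logarithmic energy -/

/-- Hadamard's inequality. -/
theorem abs_det_le_prod_norm {d : ℕ} (e : OrthonormalBasis (Fin d) ℝ (EuclideanSpace ℝ (Fin d)))
    (v : Fin d → EuclideanSpace ℝ (Fin d)) : |e.toBasis.det v| ≤ ∏ i, ‖v i‖ := by
  have : Fact (finrank ℝ (EuclideanSpace ℝ (Fin d)) = d) := ⟨by simp⟩
  rw [← e.toBasis.orientation.volumeForm_robust' e]
  exact e.toBasis.orientation.abs_volumeForm_apply_le v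

/-- The logarithmic energy `∑ μ(x) log ‖T x‖ - log |det T| / d`. -/
noncomputable def logEnergy {d : ℕ} (X : Finset (EuclideanSpace ℝ (Fin d))) (μ : EuclideanSpace ℝ (Fin d) → ℝ)
    (T : EuclideanSpace ℝ (Fin d) ≃ₗ[ℝ] EuclideanSpace ℝ (Fin d)) : ℝ :=
  ∑ x ∈ X, μ x * Real.log ‖T x‖ -
    Real.log |LinearMap.det (T : EuclideanSpace ℝ (Fin d) →ₗ[ℝ] EuclideanSpace ℝ (Fin d))| / d

/-- The greedy basis b depends on `T`, but only finitely many tuples from `X` occur. Hadamard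
applied to T b leaves log |det b| / d as a lower bound, hence a uniform one. -/
theorem bddBelow_range_logEnergy {d : ℕ} (hd : 0 < d) {X : Finset (EuclideanSpace ℝ (Fin d))}
    (hX : ∀ x ∈ X, ‖x‖ = 1) {μ : EuclideanSpace ℝ (Fin d) → ℝ} (hμ0 : ∀ x ∈ X, 0 ≤ μ x)
    (hμ : ∑ x ∈ X, μ x = 1)
    (hV : ∀ V : Submodule ℝ (EuclideanSpace ℝ (Fin d)),
      subspaceMass X μ V ≤ (finrank ℝ V : ℝ) / d) :
    BddBelow (Set.range (logEnergy X μ)) := by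
  classical
  let e := EuclideanSpace.basisFun (Fin d) ℝ
  -- Dependent tuples only add the harmless value `Real.log 0 / d = 0`.
  obtain ⟨C, hC⟩ := (Set.finite_range fun b : Fin d → X =>
    Real.log |e.toBasis.det fun i => (b i : EuclideanSpace ℝ (Fin d))| / d).bddBelow
  refine ⟨C, ?_⟩
  rintro _ ⟨T, rfl⟩
  obtain ⟨b, hb, -, hle⟩ := exists_linearIndependent_greedy hd hX hμ0 hμ hV
    (fun x => Real.log ‖T x‖) le_rfl
  have hspan : Submodule.span ℝ (Set.range fun i => (b i : EuclideanSpace ℝ (Fin d))) = ⊤ :=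
    hb.span_eq_top_of_card_eq_finrank' (by simp)
  have hd' : (d : ℝ) ≠ 0 := by positivity
  -- Any upper bound for the costs serves as c: its coefficient d/d - 1 vanishes.
  have hle' := hle (∑ i, |Real.log ‖T (b i)‖|) fun i => (le_abs_self _).trans
    (Finset.single_le_sum (f := fun i => |Real.log ‖T (b i)‖|) (fun _ _ => abs_nonneg _)
      (Finset.mem_univ i))
  rw [hspan] at hle'
  simp only [subspaceMass, Submodule.mem_top, Finset.filter_true, hμ, div_self hd', sub_self,
    zero_mul, add_zero] at hle'
  have hdetb : e.toBasis.det (fun i => (b i : EuclideanSpace ℝ (Fin d))) ≠ 0 :=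
    ((e.toBasis.is_basis_iff_det).1 ⟨hb, hspan⟩).ne_zero
  have hdetT : LinearMap.det (T : EuclideanSpace ℝ (Fin d) →ₗ[ℝ] EuclideanSpace ℝ (Fin d)) ≠ 0 :=
    T.isUnit_det'.ne_zero
  have hT := abs_det_le_prod_norm e
    ((T : EuclideanSpace ℝ (Fin d) →ₗ[ℝ] EuclideanSpace ℝ (Fin d)) ∘
      fun i => (b i : EuclideanSpace ℝ (Fin d)))
  rw [Basis.det_comp, abs_mul] at hT
  simp only [Function.comp_apply, LinearEquiv.coe_coe] at hT
  have hlog := Real.log_le_log (by positivity) hT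
  rw [Real.log_mul (by positivity) (by positivity), Real.log_prod fun i _ =>
    (norm_pos_iff.2 (apply_ne_zero_of_norm_eq_one T (hX _ (b i).2))).ne'] at hlog
  have hCb := hC ⟨b, rfl⟩
  have hlog' := (div_le_div_iff_of_pos_right (by positivity : (0 : ℝ) < d)).2 hlog
  rw [add_div] at hlog'
  unfold logEnergy
  linarith

/-! ### Stretching and near-minimizers -/

/-- For a unit vector `u` and `t > -1` there is a stretch `S` along `u`, with
`‖S y‖² = ‖y‖² + t ⟨u, y⟩²` and determinant `√(1 + t)`. -/
theorem exists_stretch {E : Type*} [NormedAddCommGroup E] [InnerProductSpace ℝ E]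
    [FiniteDimensional ℝ E] {u : E} (hu : ‖u‖ = 1) {t : ℝ} (ht : -1 < t) :
    ∃ S : E ≃ₗ[ℝ] E, LinearMap.det (S : E →ₗ[ℝ] E) = √(1 + t) ∧
      ∀ y, ‖S y‖ ^ 2 = ‖y‖ ^ 2 + t * inner ℝ y u ^ 2 := by
  let S := LinearMap.transvection ((√(1 + t) - 1) • (innerₗ E u)) u
  have hdet : LinearMap.det S = √(1 + t) := by
    simp [S, LinearMap.transvection.det, hu]
  have hpos : 0 < √(1 + t) := Real.sqrt_pos.2 (by linarith)
  have hunit : IsUnit (LinearMap.det S) := by rw [hdet]; exact hpos.ne'.isUnit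
  refine ⟨LinearMap.equivOfIsUnitDet hunit, by simpa using hdet, fun y => ?_⟩
  have hsq : √(1 + t) ^ 2 = 1 + t := Real.sq_sqrt (by linarith)
  rw [LinearMap.equivOfIsUnitDet_apply, LinearMap.transvection.apply, norm_add_sq_real, norm_smul,
    inner_smul_right, hu, mul_one, Real.norm_eq_abs, sq_abs]
  simp only [LinearMap.smul_apply, innerₗ_apply_apply, smul_eq_mul, real_inner_comm y u]
  linear_combination (inner ℝ y u) ^ 2 * hsq

/-- The change of the logarithmic energy under a stretch. -/
theorem exists_logEnergy_le {d : ℕ} {X : Finset (EuclideanSpace ℝ (Fin d))}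
    (hX : ∀ x ∈ X, ‖x‖ = 1) {μ : EuclideanSpace ℝ (Fin d) → ℝ} (hμ : ∀ x ∈ X, 0 ≤ μ x)
    (T : EuclideanSpace ℝ (Fin d) ≃ₗ[ℝ] EuclideanSpace ℝ (Fin d))
    {u : EuclideanSpace ℝ (Fin d)} (hu : ‖u‖ = 1) {t : ℝ} (ht : -(1 / 2) ≤ t) :
    ∃ T' : EuclideanSpace ℝ (Fin d) ≃ₗ[ℝ] EuclideanSpace ℝ (Fin d),
      logEnergy X μ T' ≤ logEnergy X μ T +
        (t * (∑ x ∈ X, μ x * inner ℝ (transformPoint T x) u ^ 2 - 1 / d) + 2 * t ^ 2 / d) / 2 := by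
  obtain ⟨S, hdet, hS⟩ := exists_stretch hu (show -1 < t by linarith)
  refine ⟨T.trans S, ?_⟩
  have h1t : 0 < 1 + t := by linarith
  have hlogdet : Real.log |LinearMap.det ((T.trans S : EuclideanSpace ℝ (Fin d) ≃ₗ[ℝ] _) :
        EuclideanSpace ℝ (Fin d) →ₗ[ℝ] EuclideanSpace ℝ (Fin d))| =
      Real.log (1 + t) / 2 + Real.log |LinearMap.det
        (T : EuclideanSpace ℝ (Fin d) →ₗ[ℝ] EuclideanSpace ℝ (Fin d))| := by
    rw [LinearEquiv.coe_trans, LinearMap.det_comp, hdet, abs_mul,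
      Real.log_mul (abs_ne_zero.2 (Real.sqrt_pos.2 h1t).ne')
        (abs_ne_zero.2 T.isUnit_det'.ne_zero), Real.log_abs (√(1 + t)), Real.log_sqrt h1t.le]
  have hlog : t - 2 * t ^ 2 ≤ Real.log (1 + t) := by
    -- The gap is t² (1 + 2t) / (1 + t), whence the restriction t ≥ -1/2.
    refine le_trans ?_ (Real.one_sub_inv_le_log_of_pos h1t)
    rw [← sub_nonneg]
    have : 1 - (1 + t)⁻¹ - (t - 2 * t ^ 2) = t ^ 2 * (1 + 2 * t) / (1 + t) := by
      field_simp; ring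
    rw [this]
    exact div_nonneg (mul_nonneg (sq_nonneg t) (by linarith)) h1t.le
  have hpt : ∀ x ∈ X, μ x * Real.log ‖S (T x)‖ ≤
      μ x * Real.log ‖T x‖ + t / 2 * (μ x * inner ℝ (transformPoint T x) u ^ 2) := by
    intro x hx
    have hTx : 0 < ‖T x‖ := norm_pos_iff.2 (apply_ne_zero_of_norm_eq_one T (hX x hx))
    have hSTx : 0 < ‖S (T x)‖ := norm_pos_iff.2 (apply_ne_zero_of_norm_eq_one (T.trans S) (hX x hx))
    have heq : (‖S (T x)‖ / ‖T x‖) ^ 2 = 1 + t * inner ℝ (transformPoint T x) u ^ 2 := by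
      rw [div_pow, hS, transformPoint, real_inner_smul_left]
      field_simp
    have h2 := Real.log_le_sub_one_of_pos (x := (‖S (T x)‖ / ‖T x‖) ^ 2) (by positivity)
    rw [Real.log_pow, Real.log_div hSTx.ne' hTx.ne', heq] at h2
    push_cast at h2
    have h3 := mul_le_mul_of_nonneg_left h2 (hμ x hx)
    linarith
  have hsum := Finset.sum_le_sum hpt
  rw [Finset.sum_add_distrib, ← Finset.mul_sum] at hsum
  have hlogd : (t - 2 * t ^ 2) / d ≤ Real.log (1 + t) / d :=
    div_le_div_of_nonneg_right hlog (Nat.cast_nonneg d)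
  unfold logEnergy
  rw [hlogdet]
  simp only [LinearEquiv.trans_apply]
  rw [show ∀ a b : ℝ, (a / 2 + b) / d = a / d / 2 + b / d from fun a b => by ring]
  rw [show t * (∑ x ∈ X, μ x * inner ℝ (transformPoint T x) u ^ 2 - 1 / d) + 2 * t ^ 2 / d =
    t * ∑ x ∈ X, μ x * inner ℝ (transformPoint T x) u ^ 2 - (t - 2 * t ^ 2) / d by ring]
  linarith

/-- A near-minimizer of the logarithmic energy puts `(X, μ)` in nearly isotropic position. -/
theorem exists_isIsotropicPosition {d : ℕ} (hd : 0 < d) {X : Finset (EuclideanSpace ℝ (Fin d))}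
    (hX : ∀ x ∈ X, ‖x‖ = 1) {μ : EuclideanSpace ℝ (Fin d) → ℝ} (hμ : ∀ x ∈ X, 0 ≤ μ x)
    (hbdd : BddBelow (Set.range (logEnergy X μ))) {ε : ℝ} (hε : 0 < ε) :
    ∃ T : EuclideanSpace ℝ (Fin d) ≃ₗ[ℝ] EuclideanSpace ℝ (Fin d),
      IsIsotropicPosition ε (transformSet T X) (transformWeight T X μ) := by
  have hd' : (0 : ℝ) < d := Nat.cast_pos.2 hd
  -- δ ≤ 1 keeps t = ±δ/4 admissible. With energy slack δ²/(16d), equal to the quadratic term at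
  -- these t, the two signs give exactly the two δ-isotropy bounds.
  obtain ⟨δ, hδ, hδε, hδ1⟩ : ∃ δ : ℝ, 0 < δ ∧ δ ≤ ε ∧ δ ≤ 1 :=
    ⟨min ε 1, lt_min hε one_pos, min_le_left _ _, min_le_right _ _⟩
  obtain ⟨_, ⟨T, rfl⟩, hT⟩ := exists_lt_of_csInf_lt (Set.range_nonempty (logEnergy X μ))
    (lt_add_of_pos_right (sInf (Set.range (logEnergy X μ))) (show 0 < δ ^ 2 / (16 * d) by positivity))
  have key {u : EuclideanSpace ℝ (Fin d)} (hu : ‖u‖ = 1) {t : ℝ} (ht : -(1 / 2) ≤ t) :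
      0 < δ ^ 2 / (16 * d) + (t * (∑ x ∈ X, μ x * inner ℝ (transformPoint T x) u ^ 2 - 1 / d) +
        2 * t ^ 2 / d) / 2 := by
    obtain ⟨T', hT'⟩ := exists_logEnergy_le hX hμ T hu ht
    have := csInf_le hbdd ⟨T', rfl⟩
    linarith
  refine ⟨T, fun v hv => ?_⟩
  rw [sum_transformSet T X hX μ fun y => inner ℝ y v ^ 2 / ‖v‖ ^ 2]
  have hu : ‖‖v‖⁻¹ • v‖ = 1 := norm_smul_inv_norm (𝕜 := ℝ) hv
  have hsum : ∑ x ∈ X, μ x * (inner ℝ (transformPoint T x) v ^ 2 / ‖v‖ ^ 2) =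
      ∑ x ∈ X, μ x * inner ℝ (transformPoint T x) (‖v‖⁻¹ • v) ^ 2 :=
    Finset.sum_congr rfl fun x _ => by
      rw [real_inner_smul_right, mul_pow, inv_pow]; ring
  rw [hsum]
  have h1 := key hu (t := δ / 4) (by linarith)
  have h2 := key hu (t := -(δ / 4)) (by linarith)
  generalize ∑ x ∈ X, μ x * inner ℝ (transformPoint T x) (‖v‖⁻¹ • v) ^ 2 = m at h1 h2 ⊢
  have e1 : δ ^ 2 / (16 * d) + (δ / 4 * (m - 1 / d) + 2 * (δ / 4) ^ 2 / d) / 2 =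
      δ / 8 * (m - (1 - δ) * (1 / d)) := by
    field_simp; ring
  have e2 : δ ^ 2 / (16 * d) + (-(δ / 4) * (m - 1 / d) + 2 * (-(δ / 4)) ^ 2 / d) / 2 =
      δ / 8 * ((1 + δ) * (1 / d) - m) := by
    field_simp; ring
  rw [e1] at h1
  rw [e2] at h2
  have h1' := (pos_iff_pos_of_mul_pos h1).1 (by positivity)
  have h2' := (pos_iff_pos_of_mul_pos h2).1 (by positivity)
  have h3 : (1 - ε) * (1 / (d : ℝ)) ≤ (1 - δ) * (1 / d) := by gcongr
  have h4 : (1 + δ) * (1 / (d : ℝ)) ≤ (1 + ε) * (1 / d) := by gcongr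
  constructor <;> linarith

theorem mainTheorem4 (d : ℕ) (X : Finset (EuclideanSpace ℝ (Fin d))) (hX : ∀ x ∈ X, ‖x‖ = 1)
    (μ : EuclideanSpace ℝ (Fin d) → ℝ) (hμ_nonneg : ∀ x ∈ X, 0 ≤ μ x)
    (hμ_sum : ∑ x ∈ X, μ x = 1) :
    (∀ ε : ℝ, 0 < ε → ∃ T : EuclideanSpace ℝ (Fin d) ≃ₗ[ℝ] EuclideanSpace ℝ (Fin d),
      IsIsotropicPosition ε (transformSet T X) (transformWeight T X μ)) ↔
    (∀ k : ℕ, 1 ≤ k → k ≤ d → ∀ V : Submodule ℝ (EuclideanSpace ℝ (Fin d)),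
      Module.finrank ℝ V = k → subspaceMass X μ V ≤ (k : ℝ) / (d : ℝ)) := by
  constructor
  · rintro h k - - V rfl
    refine le_of_forall_pos_le_add fun ε hε => ?_
    obtain ⟨T, hT⟩ := h ε hε
    refine (subspaceMass_le_of_isIsotropicPosition hX hμ_nonneg T hT V).trans ?_
    have : (finrank ℝ V : ℝ) / d ≤ 1 := by
      refine div_le_one_of_le₀ ?_ (Nat.cast_nonneg d)
      exact_mod_cast (Submodule.finrank_le V).trans_eq finrank_euclideanSpace_fin
    nlinarith
  · intro h ε hε
    have hd : 0 < d := by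
      rcases Nat.eq_zero_or_pos d with rfl | hd
      · have hX0 : X = ∅ := Finset.eq_empty_of_forall_notMem fun x hx => by
          have := hX x hx
          simp [Subsingleton.elim x 0] at this
        simp [hX0] at hμ_sum
      · exact hd
    refine exists_isIsotropicPosition hd hX hμ_nonneg
      (bddBelow_range_logEnergy hd hX hμ_nonneg hμ_sum fun V => ?_) hε
    -- Condition (b) starts at k = 1; the zero subspace has no mass since `X` consists of unit
    -- vectors.
    rcases Nat.eq_zero_or_pos (finrank ℝ V) with h0 | h0
    · rw [Submodule.finrank_eq_zero.1 h0, subspaceMass_bot hX]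
      positivity
    · exact h _ h0 ((Submodule.finrank_le V).trans_eq finrank_euclideanSpace_fin) V rfl
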